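/- Let $K$ be an algebraically closed field of characteristic $0$ (for example $K=\mathbb{C}$). All Lie algebras and representations are finite-dimensional over $K$. For a semisimple Lie algebra $\mathfrak{g}$ with Cartan subalgebra $\mathfrak{t}$ and a representation $V$ of $\mathfrak{g}$, the formal character of $V$ is the element $\sum_{\chi} (\dim V_\chi)\, e^{\chi}$ of the group ring $\mathbb{Z}[\mathfrak{t}^*]$, where $\chi$ runs over the weights of $\mathfrak{t}$ on $V$ and $V_\chi$ is the corresponding weight space. Representations $V_1$ of $\mathfrak{g}_1$ and $V_2$ of $\mathfrak{g}_2$ are said to have the same formal character if, for some choice of Cartan subalgebras $\mathfrak{t}_i \subset \mathfrak{g}_i$, there is a linear isomorphism $F:\mathfrak{t}_1^* \xrightarrow{\sim} \mathfrak{t}_2^*$ carrying the formal character of $V_1$ to that of $V_2$ (this does not depend on the choice of the $\mathfrak{t}_i$). Let $\mathfrak{h}$ be a semisimple Lie algebra and let $W$ be a faithful representation of $\mathfrak{h}$. Let $m \geq 3$ and suppose that $W$ has the same formal character as the standard $m$-dimensional representation of $\mathfrak{so}_m$. Then every irreducible summand (equivalently, every irreducible subrepresentation) $U$ of $W$ is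 self-dual, i.e. $U \cong U^\vee$ as representations of $\mathfrak{h}$. -/

import Mathlib

open Module

attribute [local instance 100] LieRing.ofAssociativeRing

noncomputable section

namespace FormalCharacter

variable (K : Type*) [Field K] [CharZero K]

/-- The formal character of a finite-dimensional representation `V` of `g` with respect to a Cartan
subalgebra `t`: the element `∑ χ, (dim V_χ) e^χ` of the integral group ring of `t*`, where `χ` runs
over the weights of `t` on `V`. Here `V_χ` is Mathlib's (generalized) weight space; if `g` is
semisimple, as below, then `t` acts diagonalizably and it is the ordinary weight space. -/
def formalCharacter {g : Type*} [LieRing g] [LieAlgebra K g]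
    (t : LieSubalgebra K g) [t.IsCartanSubalgebra]
    (V : Type*) [AddCommGroup V] [Module K V] [LieRingModule g V] [LieModule K g V]
    [FiniteDimensional K V] :
    AddMonoidAlgebra ℤ (Dual K t) :=
  ∑ χ : LieModule.Weight K t V,
    AddMonoidAlgebra.single (LieModule.Weight.toLinear K t V χ)
      (finrank K (LieModule.genWeightSpace V χ) : ℤ)

/-- The representation `V₁` of `g₁` and the representation `V₂` of `g₂` have the same formal
character: for some Cartan subalgebras `t₁`, `t₂` there is a linear isomorphism `t₁* ≃ t₂*` that
carries the formal character of `V₁` to that of `V₂`. -/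
def SameFormalCharacter
    (g₁ : Type*) [LieRing g₁] [LieAlgebra K g₁]
    (V₁ : Type*) [AddCommGroup V₁] [Module K V₁] [LieRingModule g₁ V₁] [LieModule K g₁ V₁]
    [FiniteDimensional K V₁]
    (g₂ : Type*) [LieRing g₂] [LieAlgebra K g₂]
    (V₂ : Type*) [AddCommGroup V₂] [Module K V₂] [LieRingModule g₂ V₂] [LieModule K g₂ V₂]
    [FiniteDimensional K V₂] : Prop :=
  ∃ (t₁ : LieSubalgebra K g₁) (_ : t₁.IsCartanSubalgebra)
    (t₂ : LieSubalgebra K g₂) (_ : t₂.IsCartanSubalgebra)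
    (F : Dual K t₁ ≃ₗ[K] Dual K t₂),
    AddMonoidAlgebra.mapDomain F (formalCharacter K t₁ V₁) = formalCharacter K t₂ V₂

/-- A representation is self-dual if it is isomorphic to its contragredient. -/
def IsSelfDual (g : Type*) [LieRing g] [LieAlgebra K g]
    (V : Type*) [AddCommGroup V] [Module K V] [LieRingModule g V] [LieModule K g V] : Prop :=
  Nonempty (V ≃ₗ⁅K, g⁆ Dual K V)

end FormalCharacter

end

/-! It suffices that the weights of `U` are symmetric under negation: the highest weight `λ` then
has `-λ` as lowest weight, and `U` and its dual share a highest weight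
(`nonempty_equiv_dual_of_symmetric_weights`). For symmetry, the key fact is that every odd function
`c` on the weights of the standard representation of `so` is evaluation at some `z` in the Cartan
subalgebra: the operator acting as `c χ` on each weight space is skew and commutes with the Cartan
subalgebra, hence lies in it. The formal character transports this to the Cartan subalgebra of `h`.
Take `c` equal to 1 on the weights of `U` whose negative is not a weight of `U`, -1 on their
negatives and 0 elsewhere. The trace of `z` on `U` is then the total dimension of the unpaired
weight spaces, and it vanishes because `h` is perfect. In characteristic 0 there are no unpaired
weights. -/

namespace LieModule

/-! ### Self-duality from extremal vectors: the graph in `U × Dual K U`. -/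

section Dual

variable {K h U : Type*} [Field K] [LieRing h] [LieAlgebra K h]
  [AddCommGroup U] [Module K U] [LieRingModule h U] [LieModule K h U] [FiniteDimensional K U]

/-- An irreducible module with a highest weight vector `up` and a lowest weight vector `um` of
opposite weights is self-dual. Here `n` plays the role of the lowering operators and `b` that of the
opposite Borel subalgebra, `lp` is a coordinate along `up` and `lm` is a highest weight vector of
the dual module. -/
theorem nonempty_equiv_dual_of_extremal_vectors [IsIrreducible K h U]
    {n b : Set h} (hspan : Submodule.span K (n ∪ b) = ⊤)
    {up um : U} {lp lm : Dual K U} (hp : lp up ≠ 0) (hm : lm um ≠ 0)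
    (hn : ∀ x ∈ n, (∀ u : U, lp ⁅x, u⁆ = 0) ∧ ⁅x, um⁆ = 0)
    (hb : ∀ x ∈ b, ∃ c : K, ⁅x, up⁆ = c • up ∧ ∀ u : U, lm ⁅x, u⁆ = -(c * lm u)) :
    Nonempty (U ≃ₗ⁅K, h⁆ Dual K U) := by
  let act (x : h) : (U × Dual K U) →ₗ[K] (U × Dual K U) :=
    (toEnd K h U x).prodMap (toEnd K h (Dual K U) x)
  have act_add (x y : h) (w) : act (x + y) w = act x w + act y w := by ext <;> simp [act]
  have act_smul (c : K) (x : h) (w) : act (c • x) w = c • act x w := by ext <;> simp [act]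
  have act_lie (x y : h) (w) : act x (act y w) = act ⁅x, y⁆ w + act y (act x w) :=
    Prod.ext (leibniz_lie x y w.1) (leibniz_lie x y w.2)
  let v : U × Dual K U := (up, lm)
  -- `M` will be the graph of the isomorphism. It is generated from `v` by `n` alone, so properties
  -- of its elements need checking only on `v` and under `n`.
  let M : Submodule K (U × Dual K U) :=
    sInf {S | v ∈ S ∧ ∀ x ∈ n, ∀ w ∈ S, act x w ∈ S}
  have hvM : v ∈ M := Submodule.mem_sInf.mpr fun S hS ↦ hS.1
  have hnM : ∀ x ∈ n, ∀ w ∈ M, act x w ∈ M := fun x hx w hw ↦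
    Submodule.mem_sInf.mpr fun S hS ↦ hS.2 x hx w (Submodule.mem_sInf.mp hw S hS)
  have hbv : ∀ x : h, act x v ∈ M := by
    intro x
    have hx : x ∈ Submodule.span K (n ∪ b) := hspan ▸ Submodule.mem_top
    induction hx using Submodule.span_induction with
    | mem x hx =>
      obtain hx | hx := hx
      · exact hnM x hx v hvM
      · obtain ⟨c, h1, h2⟩ := hb x hx
        have : act x v = c • v := by
          ext u
          · simp [act, v, h1]
          · simp [act, v, h2]
        exact this ▸ M.smul_mem c hvM
    | zero =>
      have : act 0 v = 0 := by ext <;> simp [act]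
      exact this ▸ M.zero_mem
    | add x y _ _ hx hy => exact act_add x y v ▸ M.add_mem hx hy
    | smul c x _ hx => exact act_smul c x v ▸ M.smul_mem c hx
  have hM : ∀ x : h, ∀ w ∈ M, act x w ∈ M := by
    let N : Submodule K (U × Dual K U) := M ⊓ ⨅ x : h, M.comap (act x)
    have hN : ∀ w, w ∈ N ↔ w ∈ M ∧ ∀ x : h, act x w ∈ M := fun w ↦ by simp [N]
    have : M ≤ N := sInf_le ⟨(hN v).mpr ⟨hvM, hbv⟩, fun x hx w hw ↦ by
      obtain ⟨hw1, hw2⟩ := (hN w).mp hw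
      exact (hN _).mpr ⟨hnM x hx w hw1, fun y ↦ by
        rw [act_lie]
        exact M.add_mem (hw2 _) (hnM x hx _ (hw2 y))⟩⟩
    exact fun x w hw ↦ ((hN w).mp (this hw)).2 x
  -- This linear relation holds at `v`, and both sides vanish on the image of any `x ∈ n`. It
  -- excludes `(up, 0)` and `(0, lm)` from `M`, so by irreducibility `M` meets each factor
  -- trivially.
  have hE : ∀ w ∈ M, lm um * lp w.1 = lp up * w.2 um := by
    let E : Submodule K (U × Dual K U) := LinearMap.ker
      (lm um • lp ∘ₗ LinearMap.fst K U (Dual K U) -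
        lp up • Dual.eval K U um ∘ₗ LinearMap.snd K U (Dual K U))
    have hE : ∀ w, w ∈ E ↔ lm um * lp w.1 = lp up * w.2 um := fun w ↦ by simp [E, sub_eq_zero]
    have : M ≤ E := sInf_le ⟨(hE v).mpr (by simp [v, mul_comm]), fun x hx w _ ↦ by
      obtain ⟨h1, h2⟩ := hn x hx
      exact (hE _).mpr (by simp [act, h1, h2])⟩
    exact fun w hw ↦ (hE w).mp (this hw)
  have hleft : ∀ u : U, (u, (0 : Dual K U)) ∈ M → u = 0 := by
    let P : LieSubmodule K h U :=
      { M.comap (LinearMap.inl K U (Dual K U)) with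
        lie_mem := fun {x u} hu ↦ by simpa [act] using hM x _ hu }
    have hP : ∀ u, u ∈ P ↔ (u, (0 : Dual K U)) ∈ M := fun u ↦ Iff.rfl
    obtain h0 | h1 := eq_bot_or_eq_top P
    · exact fun u hu ↦ by simpa [h0] using (hP u).mpr hu
    · have := hE _ ((hP up).mp (h1 ▸ LieSubmodule.mem_top up))
      simp [hp, hm] at this
  have hright : ∀ f : Dual K U, ((0 : U), f) ∈ M → f = 0 := by
    let Q : Submodule K (Dual K U) := M.comap (LinearMap.inr K U (Dual K U))
    have hQ : ∀ f, f ∈ Q ↔ ((0 : U), f) ∈ M := fun f ↦ Iff.rfl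
    let Y : LieSubmodule K h U :=
      { Q.dualCoannihilator with
        lie_mem := fun {x u} hu ↦ by
          change ⁅x, u⁆ ∈ Q.dualCoannihilator
          replace hu : u ∈ Q.dualCoannihilator := hu
          rw [Submodule.mem_dualCoannihilator] at hu ⊢
          intro f hf
          have := hu ⁅x, f⁆ (by simpa [act, hQ] using hM x _ ((hQ f).mp hf))
          simpa using this }
    have hY : Y.toSubmodule = Q.dualCoannihilator := rfl
    obtain h0 | h1 := eq_bot_or_eq_top Y
    · have h2 : Q = ⊤ := by
        rw [← Subspace.dualCoannihilator_dualAnnihilator_eq (W := Q), ← hY, h0]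
        simp
      have := hE _ ((hQ lm).mp (h2 ▸ Submodule.mem_top))
      simp [hp, hm] at this
    · intro f hf
      ext u
      have : u ∈ Q.dualCoannihilator := by rw [← hY, h1]; trivial
      simpa using (Submodule.mem_dualCoannihilator u).mp this f hf
  have hsurj : ∀ u : U, ∃ f : Dual K U, (u, f) ∈ M := by
    let R : LieSubmodule K h U :=
      { M.map (LinearMap.fst K U (Dual K U)) with
        lie_mem := fun {x u} hu ↦ by
          obtain ⟨w, hw, rfl⟩ := hu
          exact ⟨act x w, hM x w hw, rfl⟩ }
    have hR : ∀ u, u ∈ R ↔ ∃ w ∈ M, w.1 = u := fun u ↦ Iff.rfl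
    obtain h0 | h1 := eq_bot_or_eq_top R
    · have := (hR up).mpr ⟨v, hvM, rfl⟩
      rw [h0, LieSubmodule.mem_bot] at this
      simp [this] at hp
    · intro u
      obtain ⟨⟨u, f⟩, hw, rfl⟩ := (hR u).mp (h1 ▸ LieSubmodule.mem_top u)
      exact ⟨f, hw⟩
  have huniq : ∀ u : U, ∀ f g : Dual K U, (u, f) ∈ M → (u, g) ∈ M → f = g := by
    intro u f g hf hg
    have := M.sub_mem hf hg
    rw [Prod.mk_sub_mk, sub_self] at this
    exact sub_eq_zero.mp (hright _ this)
  choose T hT using hsurj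
  let T' : U →ₗ[K] Dual K U :=
    { toFun := T
      map_add' := fun u w ↦ huniq _ _ _ (hT _) (M.add_mem (hT u) (hT w))
      map_smul' := fun c u ↦ huniq _ _ _ (hT _) (M.smul_mem c (hT u)) }
  have hinj : Function.Injective T' := (injective_iff_map_eq_zero T').mpr fun u hu ↦
    hleft u (by have := hT u; rwa [show T u = 0 from hu] at this)
  exact ⟨{ LinearEquiv.ofInjectiveOfFinrankEq T' hinj Subspace.dual_finrank_eq.symm with
    map_lie' := fun {x u} ↦ huniq _ _ _ (hT _) (hM x _ (hT u)) }⟩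

end Dual

end LieModule

/-! ### Weight space decomposition over a nilpotent Lie algebra. -/

namespace LieModule

section Nilpotent

variable {K L M : Type*} [Field K] [LieRing L] [LieAlgebra K L]
  [LieRing.IsNilpotent L] [AddCommGroup M] [Module K M] [LieRingModule L M] [LieModule K L M]
  [FiniteDimensional K M]

theorem isInternal_genWeightSpace [IsTriangularizable K L M] [DecidableEq (Weight K L M)] :
    DirectSum.IsInternal fun χ : Weight K L M ↦ (genWeightSpace M χ).toSubmodule :=
  DirectSum.isInternal_submodule_of_iSupIndep_of_iSup_eq_top
    (LieSubmodule.iSupIndep_toSubmodule.mpr <| iSupIndep_genWeightSpace' K L M)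
    (LieSubmodule.iSup_toSubmodule_eq_top.mpr <| iSup_genWeightSpace_eq_top' K L M)

variable (K) in
/-- Every function on the weights is realised by an endomorphism that is scalar on each weight
space. -/
theorem exists_end_eq_smul_on_genWeightSpace [IsTriangularizable K L M] (c : (L → K) → K) :
    ∃ D : End K M, ∀ χ : L → K, ∀ m ∈ genWeightSpace M χ, D m = c χ • m := by
  classical
  let A : Weight K L M → Submodule K M := fun χ ↦ (genWeightSpace M χ).toSubmodule
  let e := LinearEquiv.ofBijective (DirectSum.coeLinearMap A) isInternal_genWeightSpace
  refine ⟨DirectSum.toModule K _ M (fun χ : Weight K L M ↦ c χ • (A χ).subtype) ∘ₗ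
    e.symm.toLinearMap, fun χ m hm ↦ ?_⟩
  by_cases hχ : genWeightSpace M χ = ⊥
  · have : m = 0 := by simpa [hχ] using hm
    simp [this]
  · let χ' : Weight K L M := ⟨χ, hχ⟩
    have : e.symm m = DirectSum.lof K _ (fun χ ↦ A χ) χ' ⟨m, hm⟩ := by
      rw [LinearEquiv.symm_apply_eq]
      exact (DirectSum.coeLinearMap_lof A χ' ⟨m, hm⟩).symm
    simp [this, χ']

/-- Two linear maps that agree on all weight spaces are equal. -/
theorem linearMap_ext_genWeightSpace [IsTriangularizable K L M] {N : Type*} [AddCommGroup N]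
    [Module K N] {f g : M →ₗ[K] N}
    (hfg : ∀ χ : L → K, ∀ m ∈ genWeightSpace M χ, f m = g m) : f = g := by
  rw [← LinearMap.eqLocus_eq_top, eq_top_iff, ← LieSubmodule.top_toSubmodule (L := L),
    ← iSup_genWeightSpace_eq_top K L M, LieSubmodule.iSup_toSubmodule, iSup_le_iff]
  exact fun χ m hm ↦ hfg χ m hm

theorem trace_toEnd_eq_sum_weights [IsTriangularizable K L M] (x : L) :
    LinearMap.trace K M (toEnd K L M x) =
      ∑ χ : Weight K L M, finrank K (genWeightSpace M χ) • χ x := by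
  classical
  have hx : ∀ χ : Weight K L M, Set.MapsTo (toEnd K L M x) (genWeightSpace M χ)
      (genWeightSpace M χ) := fun χ m hm ↦ LieSubmodule.lie_mem _ hm
  rw [LinearMap.trace_eq_sum_trace_restrict isInternal_genWeightSpace hx]
  exact Finset.sum_congr rfl fun χ _ ↦ trace_toEnd_genWeightSpace K L M χ x

/-- A nonzero weight space carries a linear functional that is an eigenvector of the
contragredient action. -/
theorem exists_dual_eigenvector [IsAlgClosed K] [CharZero K]
    {χ : L → K} (hχ : genWeightSpace M χ ≠ ⊥) :
    ∃ l : Dual K M, (∀ x : L, ∀ m, l ⁅x, m⁆ = χ x * l m) ∧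
      (∀ ψ : L → K, ψ ≠ χ → ∀ m ∈ genWeightSpace M ψ, l m = 0) ∧
      ∃ m ∈ genWeightSpace M χ, l m ≠ 0 := by
  classical
  let X := genWeightSpace M χ
  have : Nontrivial X := (LieSubmodule.nontrivial_iff_ne_bot K L M).mpr hχ
  obtain ⟨μ, hμ⟩ := exists_nontrivial_weightSpace_of_isNilpotent K L (Dual K X)
  obtain ⟨⟨ξ, hξ⟩, hξ0⟩ := exists_ne (0 : weightSpace (Dual K X) μ)
  replace hξ0 : ξ ≠ 0 := fun h ↦ hξ0 (by simpa using h)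
  rw [mem_weightSpace] at hξ
  replace hξ (x : L) (m : X) : ξ ⁅x, m⁆ = -(μ x) * ξ m := by
    have := LinearMap.congr_fun (hξ x) m
    simp only [Module.Dual.lie_apply, LinearMap.smul_apply, smul_eq_mul] at this
    linear_combination -this
  obtain ⟨m₀, hm₀⟩ : ∃ m : X, ξ m ≠ 0 := by
    by_contra! h
    exact hξ0 (LinearMap.ext h)
  -- `ξ` turns the nilpotent operator `x - χ x` into the scalar `-(μ x) - χ x`, which must therefore
  -- be zero.
  have hμχ (x : L) : -(μ x) = χ x := by
    obtain ⟨k, hk⟩ := isNilpotent_toEnd_sub_algebraMap M χ x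
    have key (k : ℕ) (m : X) : ξ (((toEnd K L X x - algebraMap K _ (χ x)) ^ k) m) =
        (-(μ x) - χ x) ^ k * ξ m := by
      induction k generalizing m with
      | zero => simp
      | succ k ih =>
        rw [pow_succ, Module.End.mul_apply, ih]
        simp [hξ, pow_succ]
        ring
    have h1 := key k m₀
    rw [hk, LinearMap.zero_apply, map_zero] at h1
    have h2 := (mul_eq_zero.mp h1.symm).resolve_right hm₀
    exact sub_eq_zero.mp (eq_zero_of_pow_eq_zero h2)
  obtain ⟨p, hp⟩ := exists_end_eq_smul_on_genWeightSpace (K := K) (L := L) (M := M)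
    (fun ψ ↦ if ψ = χ then 1 else 0)
  have hpX : ∀ m, p m ∈ X.toSubmodule := by
    suffices h : X.toSubmodule.mkQ ∘ₗ p = 0 by
      intro m
      simpa using LinearMap.congr_fun h m
    refine linearMap_ext_genWeightSpace (L := L) fun ψ m hm ↦ ?_
    by_cases hψ : ψ = χ
    · subst hψ
      simpa [hp ψ m hm] using hm
    · simp [hp ψ m hm, hψ]
  refine ⟨ξ ∘ₗ p.codRestrict X.toSubmodule hpX, fun x m ↦ ?_, fun ψ hψ m hm ↦ ?_, m₀, m₀.2, ?_⟩
  · have hcomm : p ∘ₗ toEnd K L M x = toEnd K L M x ∘ₗ p := by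
      refine linearMap_ext_genWeightSpace (L := L) fun ψ m hm ↦ ?_
      simp only [LinearMap.comp_apply, toEnd_apply_apply, hp ψ m hm,
        hp ψ _ (LieSubmodule.lie_mem _ hm), lie_smul]
    have : p.codRestrict X.toSubmodule hpX ⁅x, m⁆ =
        (⁅x, (⟨p m, hpX m⟩ : X)⁆ : X) :=
      Subtype.ext (LinearMap.congr_fun hcomm m)
    rw [LinearMap.comp_apply, this, hξ, hμχ]
    rfl
  · have : p.codRestrict X.toSubmodule hpX m = 0 := Subtype.ext (by simp [hp ψ m hm, hψ])
    simp [this]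
  · have : p.codRestrict X.toSubmodule hpX m₀ = m₀ := Subtype.ext (by simp [hp χ m₀ m₀.2])
    rwa [LinearMap.comp_apply, this]

end Nilpotent

end LieModule

/-! ### Highest and lowest weights of an irreducible module. -/

namespace LieModule

variable {K : Type*} [Field K] [IsAlgClosed K] [CharZero K]
  {h : Type*} [LieRing h] [LieAlgebra K h] [FiniteDimensional K h]
  (H : LieSubalgebra K h) [H.IsCartanSubalgebra]
  {U : Type*} [AddCommGroup U] [Module K U] [LieRingModule h U] [LieModule K h U]
  [FiniteDimensional K U]

/-- An irreducible module whose set of weights is symmetric is self-dual. -/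
theorem nonempty_equiv_dual_of_symmetric_weights [IsIrreducible K h U]
    (hsym : ∀ χ : H → K, genWeightSpace U χ ≠ ⊥ → genWeightSpace U (-χ) ≠ ⊥) :
    Nonempty (U ≃ₗ⁅K, h⁆ Dual K U) := by
  classical
  have := nontrivial_of_isIrreducible K h U
  -- A rational functional nonzero on every root orders the weights and separates positive from
  -- negative roots; no base is needed.
  obtain ⟨f, hf⟩ := Module.exists_dual_forall_apply_ne_zero (K := ℚ)
    (fun α : {α : Weight K H h // α.IsNonZero} ↦ (α.1 : H → K)) fun α ↦ α.2
  have : Nonempty (Weight K H U) := by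
    by_contra! contra
    simpa only [iSup_of_empty, bot_ne_top] using iSup_genWeightSpace_eq_top' K H U
  obtain ⟨lam, hlam⟩ := Finite.exists_max fun χ : Weight K H U ↦ f χ
  have hmax (χ : H → K) (hχ : genWeightSpace U χ ≠ ⊥) : f χ ≤ f lam := hlam ⟨χ, hχ⟩
  have hmin (χ : H → K) (hχ : genWeightSpace U χ ≠ ⊥) : -f lam ≤ f χ := by
    have := hmax _ (hsym χ hχ)
    rw [map_neg] at this
    linarith
  obtain ⟨up, hup0, hup⟩ := exists_forall_lie_eq_smul K H U lam
  have hup' : up ∈ genWeightSpace U lam :=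
    weightSpace_le_genWeightSpace U _ ((mem_weightSpace _ up).mpr hup)
  obtain ⟨p, hp⟩ := exists_end_eq_smul_on_genWeightSpace (K := K) (L := H) (M := U)
    (fun ψ ↦ if ψ = lam then 1 else 0)
  obtain ⟨g, hg⟩ : ∃ g : Dual K U, g up ≠ 0 := by
    by_contra! contra
    exact hup0 ((forall_dual_apply_eq_zero_iff K up).mp contra)
  -- `lm` is supported on the weight space of `-lam`; under the contragredient action it has weight
  -- `lam`.
  obtain ⟨lm, hlm, hlm0, um, hum, hlmum⟩ :=
    exists_dual_eigenvector (hsym lam lam.genWeightSpace_ne_bot)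
  have hgp : (g ∘ₗ p) up ≠ 0 := by simpa [hp _ up hup'] using hg
  refine nonempty_equiv_dual_of_extremal_vectors
    (n := {x | ∃ α : H → K, f α < 0 ∧ x ∈ LieAlgebra.rootSpace H α})
    (b := {x | x ∈ H ∨ ∃ α : H → K, 0 < f α ∧ x ∈ LieAlgebra.rootSpace H α})
    ?_ hgp hlmum ?_ ?_
  · rw [eq_top_iff, ← LieSubmodule.top_toSubmodule (L := H), ← iSup_genWeightSpace_eq_top' K H h,
      LieSubmodule.iSup_toSubmodule, iSup_le_iff]
    intro α x hx
    refine Submodule.subset_span ?_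
    by_cases hα : α.IsZero
    · refine Or.inr (Or.inl ?_)
      rw [LieSubmodule.mem_toSubmodule, hα.eq] at hx
      simpa using hx
    · obtain h1 | h1 := lt_or_gt_of_ne (hf ⟨α, hα⟩)
      · exact Or.inl ⟨α, h1, hx⟩
      · exact Or.inr (Or.inr ⟨α, h1, hx⟩)
  · rintro x ⟨α, hα, hx⟩
    constructor
    · suffices h : (g ∘ₗ p) ∘ₗ toEnd K h U x = 0 from fun u ↦ LinearMap.congr_fun h u
      refine linearMap_ext_genWeightSpace (L := H) fun χ u hu ↦ ?_
      have hxu := LieAlgebra.lie_mem_genWeightSpace_of_mem_genWeightSpace hx hu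
      by_cases hχ : genWeightSpace U χ = ⊥
      · rw [hχ, LieSubmodule.mem_bot] at hu
        simp [hu]
      · have : α + χ ≠ lam := by
          intro h
          have := hmax χ hχ
          rw [← h, map_add] at this
          linarith
        simp [hp _ _ hxu, this]
    · have hxu := LieAlgebra.lie_mem_genWeightSpace_of_mem_genWeightSpace hx hum
      have : genWeightSpace U (α + -⇑lam) = ⊥ := by
        by_contra hne
        have := hmin _ hne
        rw [map_add, map_neg] at this
        linarith
      simpa [this] using hxu
  · rintro x (hx | ⟨α, hα, hx⟩)
    · exact ⟨lam ⟨x, hx⟩, hup ⟨x, hx⟩, fun u ↦ by simpa using hlm ⟨x, hx⟩ u⟩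
    · refine ⟨0, ?_, ?_⟩
      · have hxu := LieAlgebra.lie_mem_genWeightSpace_of_mem_genWeightSpace hx hup'
        have : genWeightSpace U (α + ⇑lam) = ⊥ := by
          by_contra hne
          have := hmax _ hne
          rw [map_add] at this
          linarith
        simpa [this] using hxu
      · suffices h : lm ∘ₗ toEnd K h U x = 0 from fun u ↦ by
          simpa using LinearMap.congr_fun h u
        refine linearMap_ext_genWeightSpace (L := H) fun χ u hu ↦ ?_
        have hxu := LieAlgebra.lie_mem_genWeightSpace_of_mem_genWeightSpace hx hu
        by_cases hχ : genWeightSpace U χ = ⊥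
        · rw [hχ, LieSubmodule.mem_bot] at hu
          simp [hu]
        · refine hlm0 (α + χ) (fun h ↦ ?_) _ hxu
          have := hmin χ hχ
          have h2 := congr_arg f h
          rw [map_add, map_neg] at h2
          linarith

end LieModule

/-! ### Perfectness, trace zero and symmetry of the weights. -/

namespace LieAlgebra

/-- A semisimple Lie algebra is perfect. -/
theorem IsSemisimple.lie_top_top_eq_top (K h : Type*) [Field K] [LieRing h] [LieAlgebra K h]
    [IsSemisimple K h] : ⁅(⊤ : LieIdeal K h), (⊤ : LieIdeal K h)⁆ = ⊤ := by
  obtain ⟨J, hJ⟩ := exists_isCompl ⁅(⊤ : LieIdeal K h), (⊤ : LieIdeal K h)⁆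
  have hJJ : ⁅J, J⁆ = ⊥ := by
    rw [eq_bot_iff, ← hJ.inf_eq_bot]
    exact le_inf (LieSubmodule.mono_lie le_top le_top) (LieSubmodule.lie_le_right _ _)
  have : IsLieAbelian J := by
    rwa [LieSubmodule.lie_abelian_iff_lie_self_eq_bot]
  have : J = ⊥ := HasTrivialRadical.eq_bot_of_isSolvable J
  simpa [this] using hJ.sup_eq_top

end LieAlgebra

namespace LieModule

variable {K : Type*} [Field K] [IsAlgClosed K]
  {h : Type*} [LieRing h] [LieAlgebra K h] [LieAlgebra.IsSemisimple K h]
  (H : LieSubalgebra K h) [H.IsCartanSubalgebra]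
  {U : Type*} [AddCommGroup U] [Module K U] [LieRingModule h U] [LieModule K h U]
  [FiniteDimensional K U]

theorem sum_finrank_nsmul_weight_eq_zero (x : H) :
    ∑ χ : Weight K H U, finrank K (genWeightSpace U χ) • χ x = 0 := by
  rw [← trace_toEnd_eq_sum_weights]
  refine trace_toEnd_eq_zero_of_mem_lcs K h U (x := x) le_rfl ?_
  rw [lowerCentralSeries_succ, lowerCentralSeries_zero,
    LieAlgebra.IsSemisimple.lie_top_top_eq_top]
  trivial

/-- If every odd function on the weights is given by evaluation at an element of the Cartan
subalgebra, then the set of weights is symmetric. -/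
theorem genWeightSpace_neg_ne_bot [CharZero K] [FiniteDimensional K h]
    (hodd : ∀ c : Dual K H → K, (∀ χ, c (-χ) = -c χ) →
      ∃ z : H, ∀ χ : Dual K H, genWeightSpace U χ ≠ ⊥ → χ z = c χ)
    (χ : H → K) (hχ : genWeightSpace U χ ≠ ⊥) : genWeightSpace U (-χ) ≠ ⊥ := by
  classical
  let P : Dual K H → Prop := fun χ ↦ genWeightSpace U (χ : H → K) ≠ ⊥
  obtain ⟨z, hz⟩ := hodd
    (fun χ ↦ (if P χ ∧ ¬ P (-χ) then 1 else 0) - (if P (-χ) ∧ ¬ P χ then 1 else 0))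
    (fun χ ↦ by simp)
  have hz' (ψ : Weight K H U) : ψ z = ((if ¬ P (-ψ.toLinear) then 1 else 0 : ℕ) : K) := by
    have hψ : P ψ.toLinear := ψ.genWeightSpace_ne_bot
    have := hz ψ.toLinear hψ
    simpa [hψ] using this
  have hsum := sum_finrank_nsmul_weight_eq_zero (U := U) H z
  -- The trace is now the cast of a sum of natural numbers, so its vanishing kills every term.
  simp_rw [hz', nsmul_eq_mul] at hsum
  norm_cast at hsum
  rw [Finset.sum_eq_zero_iff] at hsum
  have := hsum ⟨χ, hχ⟩ (Finset.mem_univ _)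
  have hpos := zero_lt_finrank_genWeightSpace hχ
  by_contra hcon
  have hP : ¬ P (-(Weight.toLinear K H U ⟨χ, hχ⟩)) := not_not.mpr hcon
  simp [hP] at this
  omega

end LieModule

/-! ### Invariant bilinear forms and weight spaces. -/

namespace LieModule

variable {K L M : Type*} [Field K] [LieRing L] [LieAlgebra K L]
  [LieRing.IsNilpotent L] [AddCommGroup M] [Module K M] [LieRingModule L M] [LieModule K L M]

/-- Weight spaces whose weights do not sum to zero are orthogonal for an invariant form. -/
theorem bilin_eq_zero_of_mem_genWeightSpace {B : LinearMap.BilinForm K M}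
    (hB : ∀ (x : L) (m n : M), B ⁅x, m⁆ n = -B m ⁅x, n⁆) {χ ψ : L → K} (hχψ : χ + ψ ≠ 0)
    {m n : M} (hm : m ∈ genWeightSpace M χ) (hn : n ∈ genWeightSpace M ψ) : B m n = 0 := by
  obtain ⟨x, hx⟩ := Function.ne_iff.mp hχψ
  obtain ⟨i, hi⟩ := (mem_genWeightSpace M χ m).mp hm x
  obtain ⟨j, hj⟩ := (mem_genWeightSpace M ψ n).mp hn x
  clear hm hn
  -- Invariance gives `(χ x + ψ x) * B m n = -B ((x - χ x) m) n - B m ((x - ψ x) n)`; each term on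
  -- the right lowers one nilpotency exponent.
  induction hs : i + j generalizing i j m n with
  | zero =>
    obtain rfl : i = 0 := by omega
    have : m = 0 := by simpa using hi
    simp [this]
  | succ s ih =>
    rcases i with _ | i
    · have : m = 0 := by simpa using hi
      simp [this]
    rcases j with _ | j
    · have : n = 0 := by simpa using hj
      simp [this]
    have h1 := ih i (by rwa [pow_succ, Module.End.mul_apply] at hi) (j + 1) hj (by omega)
    have h2 := ih (i + 1) hi j (by rwa [pow_succ, Module.End.mul_apply] at hj) (by omega)
    simp only [LinearMap.sub_apply, toEnd_apply_apply, LinearMap.smul_apply, Module.End.one_apply,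
      map_sub, map_smul, smul_eq_mul, hB] at h1 h2
    have h3 : (χ x + ψ x) * B m n = 0 := by linear_combination -h1 - h2
    exact (mul_eq_zero.mp h3).resolve_left hx

end LieModule

/-! ### Odd functions on the weights of the standard representation. -/

namespace LieAlgebra.Orthogonal

open LieModule Matrix

/-- Every odd function on the weights of the standard representation of `so` with respect to a
Cartan subalgebra is given by evaluation at an element of that subalgebra. -/
theorem exists_weight_apply_eq_of_odd {K ι : Type*} [Field K] [IsAlgClosed K] [CharZero K]
    [Fintype ι] [DecidableEq ι]
    (t : LieSubalgebra K (so ι K)) [t.IsCartanSubalgebra]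
    (c : Dual K t → K) (hc : ∀ χ, c (-χ) = -c χ) :
    ∃ z : t, ∀ χ : Dual K t, genWeightSpace (ι → K) χ ≠ ⊥ → χ z = c χ := by
  let c' : (t → K) → K := Function.extend (fun χ : Dual K t ↦ (χ : t → K)) c fun _ ↦ 0
  have hc' (χ : Dual K t) : c' χ = c χ := DFunLike.coe_injective.extend_apply c _ χ
  obtain ⟨D, hD⟩ := exists_end_eq_smul_on_genWeightSpace (K := K) (L := t) (M := ι → K) c'
  have hinv (x : t) (v w : ι → K) :
      dotProductBilin K K ⁅x, v⁆ w = -dotProductBilin K K v ⁅x, w⁆ := by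
    have hx : (x : Matrix ι ι K)ᵀ = -(x : Matrix ι ι K) := (mem_so ι K _).mp x.1.2
    change ((x : Matrix ι ι K).mulVec v) ⬝ᵥ w = -(v ⬝ᵥ (x : Matrix ι ι K).mulVec w)
    rw [Matrix.dotProduct_mulVec, ← Matrix.mulVec_transpose, hx, Matrix.neg_mulVec, neg_dotProduct,
      neg_neg]
  -- Vectors in two weight spaces pair nontrivially only if the weights are opposite, and there
  -- oddness of `c` is exactly skewness of `D`.
  have hskew : (dotProductBilin K K : LinearMap.BilinForm K (ι → K)) ∘ₗ D =
      -(dotProductBilin K K : LinearMap.BilinForm K (ι → K)).compl₂ D := by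
    refine linearMap_ext_genWeightSpace (L := t) fun χ v hv ↦
      linearMap_ext_genWeightSpace (L := t) fun ψ w hw ↦ ?_
    simp only [LinearMap.comp_apply, LinearMap.neg_apply, LinearMap.compl₂_apply, hD χ v hv,
      hD ψ w hw, map_smul, LinearMap.smul_apply]
    by_cases h0 : dotProductBilin K K v w = 0
    · simp [h0]
    have hχψ : χ + ψ = 0 := by
      by_contra hne
      exact h0 (bilin_eq_zero_of_mem_genWeightSpace hinv hne hv hw)
    have hχ : genWeightSpace (ι → K) χ ≠ ⊥ := by
      intro hbot
      rw [hbot, LieSubmodule.mem_bot] at hv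
      exact h0 (by simp [hv])
    let χ' : Dual K t := Weight.toLinear K t (ι → K) ⟨χ, hχ⟩
    have h1 : c' χ = c χ' := hc' χ'
    have h2 : c' ψ = -c χ' := by
      rw [eq_neg_of_add_eq_zero_right hχψ, ← hc]
      exact hc' (-χ')
    rw [h1, h2]
    simp
  have hcomm (x : t) (v : ι → K) : D ⁅x, v⁆ = ⁅x, D v⁆ := by
    suffices h : D ∘ₗ toEnd K t (ι → K) x = toEnd K t (ι → K) x ∘ₗ D from LinearMap.congr_fun h v
    refine linearMap_ext_genWeightSpace (L := t) fun χ v hv ↦ ?_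
    simp only [LinearMap.comp_apply, toEnd_apply_apply, hD χ v hv,
      hD χ _ (LieSubmodule.lie_mem _ hv), lie_smul]
  have hDso : LinearMap.toMatrix' D ∈ so ι K := by
    rw [mem_so]
    ext i j
    have := LinearMap.congr_fun (LinearMap.congr_fun hskew (Pi.single i 1)) (Pi.single j 1)
    simpa [LinearMap.toMatrix'_apply] using this
  -- `D` commutes with `t`, hence normalizes it, and a Cartan subalgebra is its own normalizer.
  have hDt : (⟨LinearMap.toMatrix' D, hDso⟩ : so ι K) ∈ t := by
    rw [← LieSubalgebra.IsCartanSubalgebra.self_normalizing (H := t),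
      LieSubalgebra.mem_normalizer_iff]
    intro y hy
    convert t.zero_mem
    refine Subtype.ext ?_
    change LinearMap.toMatrix' D * y.1 - y.1 * LinearMap.toMatrix' D = 0
    refine sub_eq_zero.mpr (Matrix.toLin'.injective (LinearMap.ext fun v ↦ ?_))
    rw [Matrix.toLin'_mul, Matrix.toLin'_mul, Matrix.toLin'_toMatrix']
    exact hcomm ⟨y, hy⟩ v
  refine ⟨⟨_, hDt⟩, fun χ hχ ↦ ?_⟩
  let χ' : Weight K t (ι → K) := ⟨χ, hχ⟩
  obtain ⟨v, hv0, hv⟩ := exists_forall_lie_eq_smul K t (ι → K) χ'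
  have hv' : v ∈ genWeightSpace (ι → K) χ :=
    weightSpace_le_genWeightSpace _ _ ((mem_weightSpace _ v).mpr hv)
  have h1 : D v = χ ⟨_, hDt⟩ • v :=
    (LinearMap.congr_fun (Matrix.toLin'_toMatrix' D) v).symm.trans (hv ⟨_, hDt⟩)
  rw [hD χ v hv', hc'] at h1
  exact (smul_left_injective K hv0 h1).symm

end LieAlgebra.Orthogonal

/-! ### Transport along the formal character, and the theorem. -/

namespace FormalCharacter

open LieModule

variable {K : Type*} [Field K] [CharZero K]

theorem coeff_formalCharacter {g : Type*} [LieRing g] [LieAlgebra K g]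
    (t : LieSubalgebra K g) [t.IsCartanSubalgebra]
    (V : Type*) [AddCommGroup V] [Module K V] [LieRingModule g V] [LieModule K g V]
    [FiniteDimensional K V] (χ : Dual K t) :
    (formalCharacter K t V).coeff χ = finrank K (genWeightSpace V χ) := by
  classical
  simp only [formalCharacter, AddMonoidAlgebra.coeff_sum, AddMonoidAlgebra.coeff_single,
    Finsupp.finsetSum_apply, Finsupp.single_apply]
  by_cases hχ : genWeightSpace V (χ : t → K) = ⊥
  · have h0 : finrank K (⊥ : LieSubmodule K t V) = 0 := finrank_bot K V
    rw [hχ, h0, Finset.sum_eq_zero fun ψ _ ↦ if_neg ?_, Nat.cast_zero]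
    rintro rfl
    exact ψ.genWeightSpace_ne_bot' hχ
  · rw [Finset.sum_eq_single_of_mem ⟨χ, hχ⟩ (Finset.mem_univ _) fun ψ _ hψ ↦ if_neg ?_]
    · exact if_pos rfl
    · rintro rfl
      exact hψ rfl

/-- A linear isomorphism matching formal characters matches weights. -/
theorem genWeightSpace_ne_bot_of_mapDomain_eq
    {g₁ : Type*} [LieRing g₁] [LieAlgebra K g₁] {t₁ : LieSubalgebra K g₁} [t₁.IsCartanSubalgebra]
    {V₁ : Type*} [AddCommGroup V₁] [Module K V₁] [LieRingModule g₁ V₁] [LieModule K g₁ V₁]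
    [FiniteDimensional K V₁]
    {g₂ : Type*} [LieRing g₂] [LieAlgebra K g₂] {t₂ : LieSubalgebra K g₂} [t₂.IsCartanSubalgebra]
    {V₂ : Type*} [AddCommGroup V₂] [Module K V₂] [LieRingModule g₂ V₂] [LieModule K g₂ V₂]
    [FiniteDimensional K V₂] {F : Dual K t₁ ≃ₗ[K] Dual K t₂}
    (hF : AddMonoidAlgebra.mapDomain F (formalCharacter K t₁ V₁) = formalCharacter K t₂ V₂)
    {χ : Dual K t₁} (hχ : genWeightSpace V₁ χ ≠ ⊥) : genWeightSpace V₂ (F χ) ≠ ⊥ := by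
  intro hbot
  have h1 : (formalCharacter K t₂ V₂).coeff (F χ) = (formalCharacter K t₁ V₁).coeff χ := by
    rw [← hF]
    exact Finsupp.mapDomain_apply F.injective _ χ
  have h0 : finrank K (⊥ : LieSubmodule K t₂ V₂) = 0 := finrank_bot K V₂
  rw [coeff_formalCharacter, coeff_formalCharacter, hbot, h0] at h1
  have := zero_lt_finrank_genWeightSpace hχ
  omega

end FormalCharacter

theorem mainTheorem11 {K : Type*} [Field K] [IsAlgClosed K] [CharZero K]
    {h : Type*} [LieRing h] [LieAlgebra K h] [FiniteDimensional K h]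
    [LieAlgebra.IsSemisimple K h]
    {W : Type*} [AddCommGroup W] [Module K W] [LieRingModule h W] [LieModule K h W]
    [FiniteDimensional K W] [LieModule.IsFaithful K h W]
    (m : ℕ) (hm : 3 ≤ m)
    (hW : FormalCharacter.SameFormalCharacter K h W
      (LieAlgebra.Orthogonal.so (Fin m) K) (Fin m → K))
    (U : LieSubmodule K h W) (hU : LieModule.IsIrreducible K h U) :
    FormalCharacter.IsSelfDual K h U := by
  obtain ⟨t₁, _, t₂, _, F, hF⟩ := hW
  refine LieModule.nonempty_equiv_dual_of_symmetric_weights t₁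
    (LieModule.genWeightSpace_neg_ne_bot t₁ fun c hc ↦ ?_)
  obtain ⟨z₂, hz₂⟩ := LieAlgebra.Orthogonal.exists_weight_apply_eq_of_odd t₂
    (fun χ ↦ c (F.symm χ)) (fun χ ↦ by simp [hc])
  -- `z₁` is the image of `z₂` under the transpose of `F`, by reflexivity of `t₁`.
  obtain ⟨z₁, hz₁⟩ := (Module.evalEquiv K t₁).surjective (Dual.eval K t₂ z₂ ∘ₗ F.toLinearMap)
  refine ⟨z₁, fun χ hχ ↦ ?_⟩
  have hχW : LieModule.genWeightSpace W (χ : t₁ → K) ≠ ⊥ := by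
    intro hbot
    refine hχ ((LieSubmodule.eq_bot_iff _).mpr fun u hu ↦ ?_)
    have := LieModule.map_genWeightSpace_le (U.incl.restrictLie t₁) (LieSubmodule.mem_map_of_mem hu)
    rw [hbot, LieSubmodule.mem_bot] at this
    exact Subtype.ext this
  have h1 : χ z₁ = F χ z₂ := LinearMap.congr_fun hz₁ χ
  have h2 := hz₂ (F χ) (FormalCharacter.genWeightSpace_ne_bot_of_mapDomain_eq hF hχW)
  rw [h1, h2, F.symm_apply_apply]
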